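/- Let $\{X_n\}_{n\in\mathbb Z}$ be a real second-order stationary time series with autocovariance function $\gamma_X(h)=\mathrm{Cov}(X_h,X_0)$ and spectral density $f_X$, i.e. $f_X\ge 0$ is integrable on $(-\pi,\pi)$ and $\gamma_X(h)=\int_{-\pi}^{\pi}e^{ih\lambda}f_X(\lambda)\,d\lambda$ for all $h\in\mathbb Z$. Let $\lambda_0\in(0,\pi)$, $d\in(0,1/2)$, $c_f^+>0$, $c_f^->0$, and suppose that $$f_X(\lambda)=\begin{cases}\bigl(c_f^-+R_f^-(\lambda_0-\lambda)\bigr)(\lambda_0-\lambda)^{-2d}, & 0<\lambda<\lambda_0,\\ \bigl(c_f^++R_f^+(\lambda-\lambda_0)\bigr)(\lambda-\lambda_0)^{-2d}, & \lambda_0<\lambda<\pi,\end{cases}$$ where $R_f^\pm:(0,\infty)\to[-c_f^\pm,\infty)$, $R_f^\pm(x)\to0$ as $x\to0^+$, and $$R_f^-(x)=L_f^-(1/x)-c_f^-\ \ (0<x<\lambda_0),\qquad R_f^+(x)=L_f^+(1/x)-c_f^+\ \ (0<x<\pi-\lambda_0),$$ with $L_f^-:(1/\lambda_0,\infty)\to(0,\infty)$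 and $L_f^+:(1/(\pi-\lambda_0),\infty)\to(0,\infty)$ quasi-monotone slowly varying functions at $+\infty$ such that $L_f^\pm(x)\to c_f^\pm$ as $x\to+\infty$. (A slowly varying function $L:(a,\infty)\to(0,\infty)$, $a\ge 0$, is quasi-monotone if it is of bounded variation on $(a,K]$ for every $K>a$ and, for some $\delta>0$, $\int_{(a,x]}u^\delta\,|dL(u)|=O(x^\delta L(x))$ as $x\to\infty$.) Then $\{X_n\}$ exhibits cyclical long memory in the time domain, in the non-boundary case: there is a function $R_\gamma:[0,\infty)\to\mathbb R$ with $R_\gamma(x)\to0$ as $x\to\infty$ such that $$\gamma_X(h)=\bigl(c_\gamma\cos(\lambda_0h+\phi)+R_\gamma(h)\bigr)h^{2d-1},\qquad h=1,2,\dots,$$ that is, $\gamma_X(h)=c_\gamma\cos(\lambda_0h+\phi)h^{2d-1}+o(h^{2d-1})$ as $h\to\infty$, where $$c_\gamma=2\Gamma(1-2d)\sqrt{(c_f^+)^2+(c_f^-)^2-2c_f^+c_f^-\cos(2\pi d)},\qquad \phi=\arcsin\!\left(\frac{(c_f^+-c_f^-)\cos(\pi d)}{\sqrt{(c_f^+)^2+(c_f^-)^2-2c_f^+c_f^-\cos(2\pi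 d)}}\right),$$ and $c_\gamma>0$, $\phi\in\bigl(-(\tfrac12-d)\pi,(\tfrac12-d)\pi\bigr)$. -/

import Mathlib

open Real Set Filter Topology MeasureTheory ProbabilityTheory Asymptotics

noncomputable section

/-! ### Second-order stationary series and spectral densities -/

/-- A real time series `(X n)`, `n ∈ ℤ`, is second-order stationary: finite second moments,
constant mean, and covariances that depend on the lag only. -/
structure IsSecondOrderStationary {Ω : Type*} [MeasurableSpace Ω] (P : Measure Ω)
    (X : ℤ → Ω → ℝ) : Prop where
  memLp : ∀ n : ℤ, MemLp (X n) 2 P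
  mean_const : ∀ n : ℤ, ∫ ω, X n ω ∂P = ∫ ω, X 0 ω ∂P
  cov_shift : ∀ n h : ℤ, covariance (X (n + h)) (X n) P = covariance (X h) (X 0) P

/-- The autocovariance function `γ_X(h) = Cov(X_h, X_0)`
(which is `E[X_h X_0]` for a centred series). -/
def acvf {Ω : Type*} [MeasurableSpace Ω] (P : Measure Ω) (X : ℤ → Ω → ℝ) (h : ℤ) : ℝ :=
  covariance (X h) (X 0) P

/-- `f` is a spectral density of the autocovariance function `γ`: a nonnegative integrable
function on `(-π, π)` with `γ(h) = ∫_{-π}^{π} e^{ihλ} f(λ) dλ` for all integers `h`. -/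
structure IsSpectralDensity (γ : ℤ → ℝ) (f : ℝ → ℝ) : Prop where
  integrableOn : IntegrableOn f (Ioo (-π) π) volume
  nonneg : ∀ l ∈ Ioo (-π) π, 0 ≤ f l
  fourier : ∀ h : ℤ,
    ((γ h : ℝ) : ℂ) = ∫ l in (-π)..π, Complex.exp (Complex.I * (h : ℂ) * (l : ℂ)) * ((f l : ℝ) : ℂ)

/-! ### Cyclical long memory: spectral domain and time domain -/

/-- The series `X` exhibits cyclical long memory in the spectral domain, with cyclical frequency
`lam0`, memory parameter `d`, left and right constants `cm`, `cp` and left and right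
remainder functions `Rm`, `Rp`. -/
structure IsCLMSpectral {Ω : Type*} [MeasurableSpace Ω] (P : Measure Ω) (X : ℤ → Ω → ℝ)
    (lam0 d cm cp : ℝ) (Rm Rp : ℝ → ℝ) : Prop where
  stationary : IsSecondOrderStationary P X
  lam0_mem : lam0 ∈ Ioo 0 π
  d_mem : d ∈ Ioo 0 (1 / 2)
  cm_nonneg : 0 ≤ cm
  cp_nonneg : 0 ≤ cp
  sum_pos : 0 < cp + cm
  Rm_ge : ∀ x, 0 < x → -cm ≤ Rm x
  Rp_ge : ∀ x, 0 < x → -cp ≤ Rp x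
  Rm_tendsto : Tendsto Rm (𝓝[>] 0) (𝓝 0)
  Rp_tendsto : Tendsto Rp (𝓝[>] 0) (𝓝 0)
  density : ∃ f : ℝ → ℝ, IsSpectralDensity (acvf P X) f ∧
    (∀ l, 0 < l → l < lam0 → f l = (cm + Rm (lam0 - l)) * (lam0 - l) ^ (-2 * d)) ∧
    (∀ l, lam0 < l → l < π → f l = (cp + Rp (l - lam0)) * (l - lam0) ^ (-2 * d))

/-- The series `X` exhibits cyclical long memory in the time domain, with cyclical frequency
`lam0`, memory parameter `d`, constant `c` and cyclical phase `phi`. The lag `h = 0`, where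
`h ^ (2d - 1)` is infinite, is left out. -/
structure IsCLMTime {Ω : Type*} [MeasurableSpace Ω] (P : Measure Ω) (X : ℤ → Ω → ℝ)
    (lam0 d c phi : ℝ) : Prop where
  stationary : IsSecondOrderStationary P X
  lam0_mem : lam0 ∈ Ioo 0 π
  d_mem : d ∈ Ioo 0 (1 / 2)
  c_pos : 0 < c
  phi_mem : phi ∈ Icc (-((1 / 2 - d) * π)) ((1 / 2 - d) * π)
  acvf_eq : ∃ R : ℝ → ℝ, Tendsto R atTop (𝓝 0) ∧
    ∀ h : ℕ, 1 ≤ h →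
      acvf P X (h : ℤ) = (c * cos (lam0 * h + phi) + R h) * (h : ℝ) ^ (2 * d - 1)

/-! ### Quasi-monotone slowly varying functions on a half-line `(a, ∞)` -/

/-- The variation function of `L` on `(a, ∞)`: `x ↦` total variation of `L` on `(a, x]`. -/
def variationFun (a : ℝ) (L : ℝ → ℝ) (x : ℝ) : ℝ :=
  (eVariationOn L (Ioc a x)).toReal

lemma variationFun_mono {a : ℝ} {L : ℝ → ℝ} (hL : ∀ K, BoundedVariationOn L (Ioc a K)) :
    Monotone (variationFun a L) := fun _ y hxy =>
  ENNReal.toReal_mono (hL y) (eVariationOn.mono L (Ioc_subset_Ioc_right hxy))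

/-- The measure `|dL|` on `(a, ∞)` for `L` of bounded variation on every `(a, K]`: the
Lebesgue-Stieltjes measure of the variation function. -/
def absStieltjes {a : ℝ} {L : ℝ → ℝ} (hL : ∀ K, BoundedVariationOn L (Ioc a K)) : Measure ℝ :=
  (variationFun_mono hL).stieltjesFunction.measure

/-- `L : (a, ∞) → (0, ∞)` is slowly varying at `+∞`. -/
structure IsSlowlyVarying (a : ℝ) (L : ℝ → ℝ) : Prop where
  pos : ∀ x, a < x → 0 < L x
  ratio : ∀ t : ℝ, 0 < t → Tendsto (fun x => L (t * x) / L x) atTop (𝓝 1)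

/-- `L : (a, ∞) → (0, ∞)` is a quasi-monotone slowly varying function: it is slowly varying at
`+∞`, of bounded variation on `(a, K]` for every `K`, and, for some `δ > 0`,
`∫_{(a, x]} u ^ δ |dL(u)| = O(x ^ δ L(x))` as `x → ∞`. -/
structure IsQuasiMonotone (a : ℝ) (L : ℝ → ℝ) : Prop where
  slowlyVarying : IsSlowlyVarying a L
  quasi : ∃ hL : ∀ K, BoundedVariationOn L (Ioc a K), ∃ δ : ℝ, 0 < δ ∧
    (fun x => ∫ u in Ioc a x, u ^ δ ∂(absStieltjes hL)) =O[atTop] (fun x => x ^ δ * L x)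

/-! ### The constant and the phase -/

/-- `√(c₊² + c₋² - 2 c₊ c₋ cos(2πd))`. -/
def clmModulus (d cm cp : ℝ) : ℝ :=
  √(cp ^ 2 + cm ^ 2 - 2 * cp * cm * cos (2 * π * d))

/-- `c_γ = 2 Γ(1 - 2d) √(c₊² + c₋² - 2 c₊ c₋ cos(2πd))`. -/
def clmConst (d cm cp : ℝ) : ℝ :=
  2 * Gamma (1 - 2 * d) * clmModulus d cm cp

/-- `φ = arcsin ((c₊ - c₋) cos(πd) / √(c₊² + c₋² - 2 c₊ c₋ cos(2πd)))`. -/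
def clmPhase (d cm cp : ℝ) : ℝ :=
  arcsin ((cp - cm) * cos (π * d) / clmModulus d cm cp)

end

/-!
Write `α = 2d`. The spectral density of a real series is even almost everywhere
(`IsSpectralDensity.ae_even`, uniqueness of Fourier coefficients in `L¹`), so `γ(h)` is twice the
real part of `∫₀^π e^{ihλ} f(λ) dλ`. Recentring at `lam0` on either side
(`integral_cexp_mul_eq_recentred`) leaves two one-sided integrals
`∫₀^A e^{ihx} L(1/x) x ^ (-α) dx`, the left one conjugated, and the theorem reduces to
`IsQuasiMonotone.tendsto_rpow_mul_integral`: multiplied by `h ^ (1 - α)`, such an integral tends to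
`c Γ(1 - α) e^{iπ(1-α)/2}`, where `c` is the limit of `L`. The rest is trigonometry
(`two_mul_re_cexp_mul_eq`).

The integral is cut at `x = T / h`. On `(0, T / h)` the factor `L(1/x)` is replaced by `c`, and the
substitution `x = y / h` gives `c ∫₀^T e^{iy} y ^ (-α) dy`, which is within `O(T ^ (-α))` of
the Fresnel-type integral over `(0, ∞)` (`norm_integral_rpow_mul_exp_sub_le`). What remains is a
bound `O(T ^ (-α))`, uniform in `h`, for the rescaled integral over `(T / h, A)`.

This bound comes from an elementary substitute for the second mean value theorem
(`norm_integral_exp_mul_le`): if the increments of `F` are dominated by those of a decreasing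
function `W`, then `|∫_s^∞ e^{ihx} F(x) dx| ≤ (π/h) W(s)`. Quasi-monotonicity enters only through
the existence of such a `W` of order `s ^ (-α)` (`IsQuasiMonotone.exists_dominating`): as `L` has a
finite limit, the condition `∫ u ^ δ |dL(u)| = O(x ^ δ L(x))` bounds the variation of `L` over
dyadic blocks, whatever `δ > 0` is, and this suffices for every exponent `α > 0`.
-/

/-! ### Oscillatory integrals with dominated increments -/

lemma norm_cexp_I_mul_ofReal (x : ℝ) : ‖Complex.exp (Complex.I * (x : ℂ))‖ = 1 := by
  rw [mul_comm]; exact Complex.norm_exp_ofReal_mul_I _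

lemma integral_sub_comp_add_right_le {W : ℝ → ℝ} {s τ : ℝ} (hτ : 0 ≤ τ)
    (hW : AntitoneOn W (Ici s)) (hW0 : ∀ x, s ≤ x → 0 ≤ W x) {N : ℝ} (hN : s ≤ N) :
    ∫ x in s..N, (W x - W (x + τ)) ≤ τ * W s := by
  have hint : ∀ p q, s ≤ p → s ≤ q → IntervalIntegrable W volume p q := fun p q hp hq =>
    (hW.mono fun x hx => le_trans (le_inf hp hq) hx.1).intervalIntegrable
  rw [intervalIntegral.integral_sub (hint _ _ le_rfl hN)
    (by simpa using (hint (s + τ) (N + τ) (by linarith) (by linarith)).comp_add_right τ),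
    intervalIntegral.integral_comp_add_right]
  rw [intervalIntegral.integral_interval_sub_interval_comm (hint _ _ le_rfl hN)
    (hint _ _ (by linarith) (by linarith)) (hint _ _ le_rfl (by linarith))]
  have h1 : ∫ x in s..s + τ, W x ≤ ∫ _ in s..s + τ, W s :=
    intervalIntegral.integral_mono_on (by linarith) (hint _ _ le_rfl (by linarith)) (by simp)
      fun x hx => hW self_mem_Ici hx.1 hx.1
  have h2 : 0 ≤ ∫ x in N..N + τ, W x :=
    intervalIntegral.integral_nonneg (by linarith) fun x hx => hW0 x (hN.trans hx.1)
  simp at h1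
  linarith

/-- A function on a half-line whose increments are dominated by those of a nonnegative
decreasing function `W` has oscillatory integral at most `π / h` times `W` at the left end.
Translation by half a period `π / h` changes the sign of the exponential, so that twice the
integral is an integral of increments over this half period. -/
lemma norm_integral_exp_mul_le {F W : ℝ → ℝ} {s h : ℝ} (hh : 0 < h)
    (hF : IntegrableOn F (Ioi s)) (hFW : ∀ x y, s ≤ x → x ≤ y → |F x - F y| ≤ W x - W y)
    (hF0 : ∀ x, s ≤ x → |F x| ≤ W x) :
    ‖∫ x in Ioi s, Complex.exp (Complex.I * (h * x : ℝ)) * (F x : ℂ)‖ ≤ π / h * W s := by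
  set τ := π / h with hτdef
  have hτ : 0 < τ := by positivity
  have hW : AntitoneOn W (Ici s) := fun x hx y _ hxy => by
    have := (abs_nonneg _).trans (hFW x y hx hxy); linarith
  have hW0 : ∀ x, s ≤ x → 0 ≤ W x := fun x hx => (abs_nonneg _).trans (hF0 x hx)
  set G : ℝ → ℂ := fun x => Complex.exp (Complex.I * (h * x : ℝ)) * (F x : ℂ) with hG
  have hnorm : ∀ x : ℝ, ‖Complex.exp (Complex.I * (h * x : ℝ))‖ = 1 := fun x =>
    norm_cexp_I_mul_ofReal _
  have hGi : IntegrableOn G (Ioi s) := by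
    refine Integrable.bdd_mul (c := 1) hF.ofReal ?_ ?_
    · exact Continuous.aestronglyMeasurable (by fun_prop)
    · exact Eventually.of_forall fun x => (hnorm x).le
  have hshift : ∀ x : ℝ, G (x + τ) = -(Complex.exp (Complex.I * (h * x : ℝ)) * (F (x + τ) : ℂ)) := by
    intro x
    have : Complex.I * (h * (x + τ) : ℝ) = Complex.I * (h * x : ℝ) + π * Complex.I := by
      have : h * (x + τ) = h * x + π := by rw [hτdef]; field_simp
      rw [this]; push_cast; ring
    simp only [hG]
    rw [this, Complex.exp_add, Complex.exp_pi_mul_I]; ring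
  have hGi2 : IntegrableOn G (Ioi (s + τ)) := hGi.mono_set (Ioi_subset_Ioi (by linarith))
  have hGτ : IntegrableOn (fun x => G (x + τ)) (Ioi s) := by
    have := (MeasurePreserving.integrableOn_comp_preimage (f := G) (s := Ioi (s + τ))
      (measurePreserving_add_right volume τ) (measurableEmbedding_addRight τ)).2 hGi2
    simpa [Function.comp_def] using this
  have e1 : ∫ x in Ioi s, G (x + τ) = ∫ x in Ioi (s + τ), G x := by
    have := (measurePreserving_add_right volume τ).setIntegral_preimage_emb
      (measurableEmbedding_addRight τ) G (Ioi (s + τ))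
    simpa using this
  have e2 : ∫ x in Ioi s, G x = (∫ x in s..s + τ, G x) + ∫ x in Ioi (s + τ), G x := by
    rw [intervalIntegral.integral_of_le (by linarith), ← setIntegral_union
      (Set.Ioc_disjoint_Ioi le_rfl) measurableSet_Ioi (hGi.mono_set Ioc_subset_Ioi_self) hGi2,
      Ioc_union_Ioi_eq_Ioi (by linarith)]
  have e3 : 2 * ∫ x in Ioi s, G x = (∫ x in s..s + τ, G x) + ∫ x in Ioi s, (G x + G (x + τ)) := by
    rw [integral_add hGi hGτ, e1, two_mul]; nth_rewrite 1 [e2]; ring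
  have b1 : ‖∫ x in s..s + τ, G x‖ ≤ W s * |s + τ - s| := by
    refine intervalIntegral.norm_integral_le_of_norm_le_const fun x hx => ?_
    rw [uIoc_of_le (by linarith)] at hx
    have hsx : s ≤ x := hx.1.le
    simp only [hG]
    rw [norm_mul, hnorm, one_mul, Complex.norm_real, norm_eq_abs]
    exact (hF0 x hsx).trans (hW self_mem_Ici hsx hsx)
  have b2 : ‖∫ x in Ioi s, (G x + G (x + τ))‖ ≤ τ * W s := by
    have hlim := intervalIntegral_tendsto_integral_Ioi s (hGi.add hGτ) tendsto_id
    refine le_of_tendsto hlim.norm ?_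
    filter_upwards [eventually_ge_atTop s] with N hN
    refine le_trans ?_ (integral_sub_comp_add_right_le hτ.le hW hW0 hN)
    refine intervalIntegral.norm_integral_le_of_norm_le hN ?_ ?_
    · refine Eventually.of_forall fun x hx => ?_
      have hsx : s ≤ x := hx.1.le
      have : G x + G (x + τ) = Complex.exp (Complex.I * (h * x : ℝ)) * ((F x - F (x + τ) : ℝ) : ℂ) := by
        rw [hshift]; simp only [hG]; push_cast; ring
      simp only [Pi.add_apply]
      rw [this, norm_mul, hnorm, one_mul, Complex.norm_real, norm_eq_abs]
      exact hFW x _ hsx (by linarith)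
    · have hint : ∀ p q, s ≤ p → s ≤ q → IntervalIntegrable W volume p q := fun p q hp hq =>
        (hW.mono fun x hx => le_trans (le_inf hp hq) hx.1).intervalIntegrable
      exact (hint _ _ le_rfl hN).sub
        (by simpa using (hint (s + τ) (N + τ) (by linarith) (by linarith)).comp_add_right τ)
  have b3 : ‖2 * ∫ x in Ioi s, G x‖ ≤ 2 * (τ * W s) := by
    rw [e3]
    refine (norm_add_le _ _).trans ?_
    rw [add_sub_cancel_left, abs_of_pos hτ] at b1
    linarith
  rw [norm_mul, Complex.norm_two] at b3
  linarith

/-! ### The Fresnel-type integral -/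

lemma integrableOn_rpow_mul_exp_neg_mul {s r : ℝ} (hs : -1 < s) (hr : 0 < r) :
    IntegrableOn (fun t : ℝ => t ^ s * exp (-(r * t))) (Ioi 0) := by
  simpa using integrableOn_rpow_mul_exp_neg_mul_rpow hs one_pos hr

lemma norm_cexp_neg_mul_ofReal (z : ℂ) (t : ℝ) : ‖Complex.exp (-(z * t))‖ = exp (-(z.re * t)) := by
  rw [Complex.norm_exp]; simp

lemma aestronglyMeasurable_rpow_mul_cexp (s : ℝ) (z : ℂ) (μ : Measure ℝ) :
    AEStronglyMeasurable (fun t : ℝ => ((t ^ s : ℝ) : ℂ) * Complex.exp (-(z * t))) μ := by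
  refine Measurable.aestronglyMeasurable ?_
  fun_prop

lemma differentiableAt_integral_rpow_mul_cexp {b : ℝ} (hb : 0 < b) {z : ℂ} (hz : 0 < z.re) :
    DifferentiableAt ℂ
      (fun z : ℂ => ∫ t in Ioi (0 : ℝ), ((t ^ (b - 1) : ℝ) : ℂ) * Complex.exp (-(z * t))) z := by
  have hs : {w : ℂ | z.re / 2 < w.re} ∈ 𝓝 z :=
    (isOpen_lt continuous_const Complex.continuous_re).mem_nhds (by simp; linarith)
  refine (hasDerivAt_integral_of_dominated_loc_of_deriv_le (μ := volume.restrict (Ioi 0)) hs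
    (F := fun (z : ℂ) (t : ℝ) => ((t ^ (b - 1) : ℝ) : ℂ) * Complex.exp (-(z * t)))
    (F' := fun (z : ℂ) (t : ℝ) => -t * (((t ^ (b - 1) : ℝ) : ℂ) * Complex.exp (-(z * t))))
    (bound := fun t => t ^ b * exp (-(z.re / 2 * t)))
    (Eventually.of_forall fun w => aestronglyMeasurable_rpow_mul_cexp _ _ _) ?_ ?_ ?_
    (integrableOn_rpow_mul_exp_neg_mul (by linarith) (by linarith)) ?_).2.differentiableAt
  · refine (integrableOn_rpow_mul_exp_neg_mul (s := b - 1) (by linarith) hz).mono'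
      (aestronglyMeasurable_rpow_mul_cexp _ _ _) ?_
    filter_upwards [ae_restrict_mem measurableSet_Ioi] with t ht
    rw [norm_mul, norm_cexp_neg_mul_ofReal, Complex.norm_real, norm_eq_abs,
      abs_of_nonneg (rpow_nonneg (le_of_lt ht) _)]
  · exact (by fun_prop : Continuous fun t : ℝ => -(t : ℂ)).aestronglyMeasurable.mul
      (aestronglyMeasurable_rpow_mul_cexp _ _ _)
  · filter_upwards [ae_restrict_mem measurableSet_Ioi] with t ht w hw
    have ht : 0 < t := ht
    rw [norm_mul, norm_mul, norm_cexp_neg_mul_ofReal, Complex.norm_real, norm_eq_abs, norm_neg,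
      Complex.norm_real, norm_eq_abs, abs_of_pos ht,
      abs_of_nonneg (rpow_nonneg (le_of_lt ht) _), ← mul_assoc, mul_comm t, ← rpow_add_one ht.ne',
      sub_add_cancel]
    have hw : z.re / 2 < w.re := hw
    gcongr
  · filter_upwards with t w _
    have h1 : HasDerivAt (fun w : ℂ => -(w * t)) (-(t : ℂ)) w := by
      simpa using ((hasDerivAt_id w).mul_const (t : ℂ)).fun_neg
    refine (h1.cexp.const_mul ((t ^ (b - 1) : ℝ) : ℂ)).congr_deriv ?_
    ring

/-- The Gamma integral with a complex rate in the right half-plane, by analytic continuation from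
real rates. -/
lemma integral_rpow_mul_cexp_neg_mul {b : ℝ} (hb : 0 < b) {z : ℂ} (hz : 0 < z.re) :
    ∫ t in Ioi (0 : ℝ), ((t ^ (b - 1) : ℝ) : ℂ) * Complex.exp (-(z * t))
      = z ^ (-b : ℂ) * Gamma b := by
  have hU : IsOpen {w : ℂ | 0 < w.re} := isOpen_lt continuous_const Complex.continuous_re
  have hf : AnalyticOnNhd ℂ
      (fun z : ℂ => ∫ t in Ioi (0 : ℝ), ((t ^ (b - 1) : ℝ) : ℂ) * Complex.exp (-(z * t)))
      {w : ℂ | 0 < w.re} :=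
    DifferentiableOn.analyticOnNhd
      (fun w hw => (differentiableAt_integral_rpow_mul_cexp hb hw).differentiableWithinAt) hU
  have hg : AnalyticOnNhd ℂ (fun z : ℂ => z ^ (-b : ℂ) * Gamma b) {w : ℂ | 0 < w.re} := by
    refine DifferentiableOn.analyticOnNhd (fun w hw => ?_) hU
    exact ((differentiableAt_id.cpow (differentiableAt_const _) (Or.inl hw)).mul_const
      _).differentiableWithinAt
  refine hf.eqOn_of_preconnected_of_frequently_eq hg
    ((convex_halfSpace_re_gt 0).isPreconnected) (z₀ := 1) (by simp) ?_ hz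
  -- Real rates accumulate at `1`.
  have hlim : Tendsto (fun n : ℕ => ((1 + 1 / ((n : ℝ) + 1) : ℝ) : ℂ)) atTop (𝓝[≠] 1) := by
    refine tendsto_nhdsWithin_iff.2 ⟨?_, Eventually.of_forall fun n => ?_⟩
    · have : Tendsto (fun n : ℕ => (1 + 1 / ((n : ℝ) + 1) : ℝ)) atTop (𝓝 (1 + 0)) :=
        tendsto_const_nhds.add tendsto_one_div_add_atTop_nhds_zero_nat
      have h2 := (Complex.continuous_ofReal.tendsto _).comp this
      simpa [Function.comp_def] using h2
    · have : (1 + 1 / ((n : ℝ) + 1) : ℝ) ≠ 1 := by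
        have : 0 < 1 / ((n : ℝ) + 1) := by positivity
        linarith
      rw [mem_compl_iff, mem_singleton_iff]
      exact_mod_cast this
  refine hlim.frequently (Frequently.of_forall fun n => ?_)
  set r : ℝ := 1 + 1 / ((n : ℝ) + 1)
  have hr : 0 < r := by positivity
  have h := integral_rpow_mul_exp_neg_mul_Ioi hb hr
  have h1 : ∫ t in Ioi (0 : ℝ), ((t ^ (b - 1) : ℝ) : ℂ) * Complex.exp (-((r : ℂ) * t))
      = ((∫ t in Ioi (0 : ℝ), t ^ (b - 1) * exp (-(r * t)) : ℝ) : ℂ) := by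
    rw [← integral_complex_ofReal]
    push_cast; rfl
  rw [h1, h, one_div, inv_rpow hr.le, ← rpow_neg hr.le]
  push_cast [Complex.ofReal_cpow hr.le]
  rfl

/-- The Fresnel-type integral `∫₀^∞ y^(-α) e^{iy} dy = Γ(1 - α) e^{iπ(1-α)/2}`, as a statement on
truncated integrals with an explicit rate. -/
lemma norm_integral_rpow_mul_exp_sub_le {α T : ℝ} (h0 : 0 < α) (h1 : α < 1) (hT : 0 < T) :
    ‖(∫ y in (0 : ℝ)..T, Complex.exp (Complex.I * y) * ((y ^ (-α) : ℝ) : ℂ))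
      - Gamma (1 - α) * Complex.exp (Complex.I * (π * (1 - α) / 2 : ℝ))‖ ≤ π * T ^ (-α) := by
  -- With the factor `e^{-εy}` the full integral is a Gamma integral, and its tail beyond `T` is
  -- bounded uniformly in `ε`, the modulus of the integrand being decreasing.
  have key : ∀ ε : ℝ, 0 < ε →
      ‖(∫ y in (0 : ℝ)..T, ((y ^ (-α) : ℝ) : ℂ) * Complex.exp (-((ε - Complex.I) * y)))
        - (ε - Complex.I : ℂ) ^ (-(1 - α : ℝ) : ℂ) * Gamma (1 - α)‖ ≤ π * T ^ (-α) := by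
    intro ε hε
    have hre : (ε - Complex.I : ℂ).re = ε := by simp
    have hI : IntegrableOn (fun y : ℝ => y ^ (-α) * exp (-(ε * y))) (Ioi 0) :=
      integrableOn_rpow_mul_exp_neg_mul (by linarith) hε
    have hIc : IntegrableOn
        (fun y : ℝ => ((y ^ (-α) : ℝ) : ℂ) * Complex.exp (-((ε - Complex.I) * y))) (Ioi 0) := by
      refine hI.mono' (aestronglyMeasurable_rpow_mul_cexp _ _ _) ?_
      filter_upwards [ae_restrict_mem measurableSet_Ioi] with t ht
      rw [norm_mul, norm_cexp_neg_mul_ofReal, Complex.norm_real, norm_eq_abs,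
        abs_of_nonneg (rpow_nonneg (le_of_lt ht) _), hre]
    have hG := integral_rpow_mul_cexp_neg_mul (b := 1 - α) (by linarith)
      (z := (ε - Complex.I : ℂ)) (by rw [hre]; exact hε)
    rw [show (1 - α - 1 : ℝ) = -α by ring, ← Ioc_union_Ioi_eq_Ioi hT.le,
      setIntegral_union (Set.Ioc_disjoint_Ioi le_rfl) measurableSet_Ioi
        (hIc.mono_set Ioc_subset_Ioi_self) (hIc.mono_set (Ioi_subset_Ioi hT.le))] at hG
    rw [← hG, intervalIntegral.integral_of_le hT.le, sub_add_cancel_left, norm_neg]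
    have hanti : ∀ x y : ℝ, T ≤ x → x ≤ y →
        y ^ (-α) * exp (-(ε * y)) ≤ x ^ (-α) * exp (-(ε * x)) := by
      intro x y hx hxy
      have hx0 : 0 < x := hT.trans_le hx
      refine mul_le_mul (rpow_le_rpow_of_nonpos hx0 hxy (by linarith)) ?_ (exp_pos _).le
        (rpow_nonneg hx0.le _)
      exact exp_le_exp.2 (by nlinarith)
    have h := norm_integral_exp_mul_le (F := fun y : ℝ => y ^ (-α) * exp (-(ε * y)))
      (W := fun y : ℝ => y ^ (-α) * exp (-(ε * y))) (s := T) one_pos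
      (hI.mono_set (Ioi_subset_Ioi hT.le))
      (fun x y hx hxy => by rw [abs_of_nonneg (by linarith [hanti x y hx hxy])])
      (fun x hx => by rw [abs_of_nonneg]; have := hT.trans_le hx; positivity)
    refine le_trans (le_of_eq ?_) (h.trans ?_)
    · congr 1
      refine setIntegral_congr_fun measurableSet_Ioi fun y _ => ?_
      simp only [one_mul]
      push_cast
      rw [mul_comm (Complex.exp _), mul_assoc, ← Complex.exp_add]
      ring_nf
    · rw [div_one]
      have : exp (-(ε * T)) ≤ 1 := exp_le_one_iff.2 (by nlinarith)
      have hT' : 0 ≤ T ^ (-α) := rpow_nonneg hT.le _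
      nlinarith [pi_pos, mul_nonneg pi_pos.le (mul_nonneg hT' (sub_nonneg.2 this))]
  have hint : IntegrableOn (fun y : ℝ => y ^ (-α)) (Ioc 0 T) := by
    have := intervalIntegral.intervalIntegrable_rpow' (a := 0) (b := T) (r := -α) (by linarith)
    rwa [intervalIntegrable_iff_integrableOn_Ioc_of_le hT.le] at this
  have hε : Tendsto (fun ε : ℝ => (ε : ℂ)) (𝓝[>] 0) (𝓝 0) :=
    (Complex.continuous_ofReal.tendsto' 0 0 (by simp)).mono_left nhdsWithin_le_nhds
  have lim1 : Tendsto
      (fun ε : ℝ => ∫ y in (0 : ℝ)..T, ((y ^ (-α) : ℝ) : ℂ) * Complex.exp (-((ε - Complex.I) * y)))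
      (𝓝[>] 0)
      (𝓝 (∫ y in (0 : ℝ)..T, Complex.exp (Complex.I * y) * ((y ^ (-α) : ℝ) : ℂ))) := by
    simp only [intervalIntegral.integral_of_le hT.le]
    refine tendsto_integral_filter_of_dominated_convergence (fun y : ℝ => y ^ (-α))
      (Eventually.of_forall fun ε => aestronglyMeasurable_rpow_mul_cexp _ _ _) ?_ hint ?_
    · filter_upwards [self_mem_nhdsWithin] with ε hε
      have hε : 0 < ε := hε
      filter_upwards [ae_restrict_mem measurableSet_Ioc] with t ht
      rw [norm_mul, norm_cexp_neg_mul_ofReal, Complex.norm_real, norm_eq_abs,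
        abs_of_nonneg (rpow_nonneg ht.1.le _)]
      refine mul_le_of_le_one_right (rpow_nonneg ht.1.le _) (exp_le_one_iff.2 ?_)
      have := mul_pos hε ht.1
      simpa using this.le
    · refine Eventually.of_forall fun y => ?_
      have hc : Continuous fun w : ℂ => ((y ^ (-α) : ℝ) : ℂ) * Complex.exp (-((w - Complex.I) * y)) := by
        fun_prop
      have := (hc.tendsto 0).comp hε
      rw [mul_comm (Complex.exp _)]
      simpa [Function.comp_def] using this
  have lim2 : Tendsto (fun ε : ℝ => (ε - Complex.I : ℂ) ^ (-(1 - α : ℝ) : ℂ) * Gamma (1 - α))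
      (𝓝[>] 0) (𝓝 (Gamma (1 - α) * Complex.exp (Complex.I * (π * (1 - α) / 2 : ℝ)))) := by
    have hc : ContinuousAt (fun w : ℂ => (w - Complex.I) ^ (-(1 - α : ℝ) : ℂ) * Gamma (1 - α)) 0 := by
      refine ContinuousAt.mul (ContinuousAt.cpow (by fun_prop) continuousAt_const ?_)
        continuousAt_const
      simp [Complex.mem_slitPlane_iff]
    have := hc.tendsto.comp hε
    refine (this.congr fun _ => rfl).mono_right (le_of_eq ?_)
    congr 1
    rw [zero_sub, Complex.cpow_def_of_ne_zero (by simp), Complex.log_neg_I, mul_comm]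
    congr 2
    push_cast; ring
  refine le_of_tendsto (lim1.sub lim2).norm ?_
  filter_upwards [self_mem_nhdsWithin] with ε hε using key ε hε

/-! ### Variation of quasi-monotone functions -/

lemma variationFun_nonneg (a : ℝ) (L : ℝ → ℝ) (x : ℝ) : 0 ≤ variationFun a L x :=
  ENNReal.toReal_nonneg

lemma variationFun_self (a : ℝ) (L : ℝ → ℝ) : variationFun a L a = 0 := by
  simp [variationFun, eVariationOn.subsingleton]

lemma abs_sub_le_variationFun_sub {a : ℝ} {L : ℝ → ℝ}
    (hL : ∀ K, BoundedVariationOn L (Ioc a K)) {v u : ℝ} (hv : a < v) (hvu : v ≤ u) :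
    |L u - L v| ≤ variationFun a L u - variationFun a L v := by
  have h1 : eVariationOn L (Ioc a v) + eVariationOn L (Icc v u) ≤ eVariationOn L (Ioc a u) := by
    refine (eVariationOn.add_le_union L fun x hx y hy => hx.2.trans hy.1).trans
      (eVariationOn.mono L ?_)
    rintro x (hx | hx)
    · exact ⟨hx.1, hx.2.trans hvu⟩
    · exact ⟨hv.trans_le hx.1, hx.2⟩
  have h2 : BoundedVariationOn L (Icc v u) :=
    (hL u).mono fun x hx => ⟨hv.trans_le hx.1, hx.2⟩
  have h3 := h2.dist_le (right_mem_Icc.2 hvu) (left_mem_Icc.2 hvu)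
  rw [Real.dist_eq] at h3
  have h4 := ENNReal.toReal_mono (hL u) h1
  rw [ENNReal.toReal_add (hL v) h2] at h4
  unfold variationFun
  linarith

/-- The variation function of a quasi-monotone function with a finite limit grows by a bounded
amount over dyadic blocks. Beyond bounded variation on bounded sets, nothing else is used of
quasi-monotonicity. -/
lemma IsQuasiMonotone.exists_dyadic_bound {a c : ℝ} {L : ℝ → ℝ} (ha : 0 < a)
    (h : IsQuasiMonotone a L) (hc : Tendsto L atTop (𝓝 c)) :
    ∃ D, 0 ≤ D ∧ ∀ x, 0 < x → variationFun a L (2 * x) - variationFun a L x ≤ D := by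
  obtain ⟨hL, δ, hδ, hO⟩ := h.quasi
  have hmono := variationFun_mono hL
  have hOc : (fun x => ∫ u in Ioc a x, u ^ δ ∂(absStieltjes hL)) =O[atTop] fun x => x ^ δ := by
    have h1 : L =O[atTop] (fun _ => (1 : ℝ)) := hc.isBigO_one ℝ
    simpa using hO.trans ((isBigO_refl (fun x : ℝ => x ^ δ) atTop).mul h1)
  obtain ⟨C, hC⟩ := hOc.bound
  obtain ⟨x0, hx0⟩ := (hC.and (eventually_gt_atTop (2 * a))).exists_forall_of_atTop
  have hx0' : 2 * a < x0 := (hx0 x0 le_rfl).2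
  have large : ∀ x, x0 ≤ x → variationFun a L (2 * x) - variationFun a L x ≤ C * 4 ^ δ := by
    intro x hx
    have hax : 2 * a < x := (hx0 x hx).2
    have hxpos : 0 < x := by linarith
    have hb := (hx0 (2 * x) (by linarith)).1
    set μ := absStieltjes hL with hμ
    have hfin : ∀ p q : ℝ, μ (Ioc p q) ≠ ⊤ := fun p q => by
      rw [hμ, absStieltjes, StieltjesFunction.measure_Ioc]; exact ENNReal.ofReal_ne_top
    have hint : IntegrableOn (fun u : ℝ => u ^ δ) (Ioc a (2 * x)) μ := by
      refine Measure.integrableOn_of_bounded (M := (2 * x) ^ δ) (hfin _ _)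
        (Measurable.aestronglyMeasurable (by fun_prop)) ?_
      filter_upwards [ae_restrict_mem measurableSet_Ioc] with u hu
      have hu0 : 0 ≤ u := ha.le.trans hu.1.le
      rw [norm_eq_abs, abs_of_nonneg (rpow_nonneg hu0 _)]
      exact rpow_le_rpow hu0 hu.2 hδ.le
    have hsub : Ioc (x / 2) (2 * x) ⊆ Ioc a (2 * x) := Ioc_subset_Ioc_left (by linarith)
    have l1 : (x / 2) ^ δ * (μ (Ioc (x / 2) (2 * x))).toReal
        ≤ ∫ u in Ioc (x / 2) (2 * x), u ^ δ ∂μ := by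
      have : ∫ _ in Ioc (x / 2) (2 * x), (x / 2) ^ δ ∂μ ≤ ∫ u in Ioc (x / 2) (2 * x), u ^ δ ∂μ := by
        refine setIntegral_mono_on (integrableOn_const (hfin _ _)) (hint.mono_set hsub)
          measurableSet_Ioc fun u hu => ?_
        exact rpow_le_rpow (by positivity) hu.1.le hδ.le
      rw [setIntegral_const, smul_eq_mul, mul_comm] at this
      exact this
    have l2 : ∫ u in Ioc (x / 2) (2 * x), u ^ δ ∂μ ≤ ∫ u in Ioc a (2 * x), u ^ δ ∂μ := by
      refine setIntegral_mono_set hint ?_ hsub.eventuallyLE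
      filter_upwards [ae_restrict_mem measurableSet_Ioc] with u hu
      exact rpow_nonneg (ha.le.trans hu.1.le) _
    have l3 : variationFun a L (2 * x) - variationFun a L x
        ≤ (μ (Ioc (x / 2) (2 * x))).toReal := by
      rw [hμ, absStieltjes, StieltjesFunction.measure_Ioc, Monotone.stieltjesFunction_eq,
        Monotone.stieltjesFunction_eq]
      -- The measure sees right limits of the variation function, so the block is enlarged.
      have r1 := hmono.le_rightLim (x := 2 * x) le_rfl
      have r2 := hmono.rightLim_le (x := x / 2) (y := x) (by linarith)
      have r3 := hmono (show x ≤ 2 * x by linarith)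
      rw [ENNReal.toReal_ofReal (by linarith)]
      linarith
    have hpos : 0 < (x / 2) ^ δ := by positivity
    have l4 : (x / 2) ^ δ * (variationFun a L (2 * x) - variationFun a L x)
        ≤ (x / 2) ^ δ * (C * 4 ^ δ) := by
      calc _ ≤ (x / 2) ^ δ * (μ (Ioc (x / 2) (2 * x))).toReal := by gcongr
        _ ≤ ∫ u in Ioc a (2 * x), u ^ δ ∂μ := l1.trans l2
        _ ≤ C * (2 * x) ^ δ := by
          refine (le_abs_self _).trans ?_
          simpa [abs_of_nonneg (rpow_nonneg (show 0 ≤ 2 * x by linarith) δ)] using hb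
        _ = (x / 2) ^ δ * (C * 4 ^ δ) := by
          rw [show 2 * x = (x / 2) * 4 by ring, mul_rpow (by positivity) (by norm_num)]; ring
    exact le_of_mul_le_mul_left l4 hpos
  have nonneg : ∀ x, 0 < x → 0 ≤ variationFun a L (2 * x) - variationFun a L x := fun x hx =>
    sub_nonneg.2 (hmono (by linarith))
  refine ⟨max (C * 4 ^ δ) (variationFun a L (2 * x0)),
    (variationFun_nonneg _ _ _).trans (le_max_right _ _), fun x hx => ?_⟩
  rcases le_total x0 x with hxx | hxx
  · exact (large x hxx).trans (le_max_left _ _)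
  · refine le_trans ?_ (le_max_right _ _)
    have := hmono (show 2 * x ≤ 2 * x0 by linarith)
    linarith [variationFun_nonneg a L x]

/-- The increments of a monotone function that grows by a bounded amount over dyadic blocks are
bounded by any positive power of the ratio of the end points. -/
lemma exists_sub_le_mul_div_rpow {V : ℝ → ℝ} (hV : Monotone V) {D β : ℝ} (hD : 0 ≤ D) (hβ : 0 < β)
    (h : ∀ x, 0 < x → V (2 * x) - V x ≤ D) :
    ∃ E, 0 ≤ E ∧ ∀ w u, 0 < w → w ≤ u → V u - V w ≤ E * (u / w) ^ β := by
  have hq : (2 : ℝ) ^ (-β) < 1 := rpow_lt_one_of_one_lt_of_neg one_lt_two (by linarith)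
  have hq0 : 0 < (2 : ℝ) ^ (-β) := by positivity
  set q : ℝ := (2 : ℝ) ^ (-β) with hqdef
  have hE : 0 ≤ D / (1 - q) := div_nonneg hD (by linarith)
  have hDE : D = D / (1 - q) * (1 - q) := by field_simp [show (1 - q) ≠ 0 by linarith]
  have hone : ∀ w u : ℝ, 0 < w → w ≤ u → 1 ≤ (u / w) ^ β := fun w u hw hu =>
    one_le_rpow ((one_le_div hw).2 hu) hβ.le
  refine ⟨D / (1 - q), hE, ?_⟩
  have main : ∀ n : ℕ, ∀ w u, 0 < w → w ≤ u → u ≤ 2 ^ n * w →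
      V u - V w ≤ D / (1 - q) * (u / w) ^ β := by
    intro n
    induction n with
    | zero =>
      intro w u hw hwu hu
      have : u = w := le_antisymm (by simpa using hu) hwu
      rw [this, sub_self]
      positivity
    | succ n ih =>
      intro w u hw hwu hu
      have h1 := hone w u hw hwu
      rcases le_total u (2 * w) with h2 | h2
      · have h3 := hV h2
        have h4 := h w hw
        nlinarith [mul_nonneg hE hq0.le, mul_nonneg hE (sub_nonneg.2 h1)]
      · have h3 := ih (2 * w) u (by linarith) h2 (by rw [pow_succ] at hu; linarith)
        have h4 := h w hw
        have h5 : (u / (2 * w)) ^ β = (u / w) ^ β * q := by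
          rw [show u / (2 * w) = (u / w) * 2⁻¹ by field_simp,
            mul_rpow (div_nonneg (by linarith) hw.le) (by norm_num), inv_rpow (by norm_num),
            ← rpow_neg (by norm_num)]
        rw [h5] at h3
        nlinarith [mul_nonneg (mul_nonneg hE (sub_nonneg.2 hq.le)) (sub_nonneg.2 h1)]
  intro w u hw hwu
  obtain ⟨n, hn⟩ := pow_unbounded_of_one_lt (u / w) (one_lt_two (α := ℝ))
  exact main n w u hw hwu (by rw [div_lt_iff₀ hw] at hn; exact hn.le)

lemma integral_mul_rpow_sub_one {α p q : ℝ} (hα : 0 < α) :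
    ∫ w in p..q, α * w ^ (α - 1) = q ^ α - p ^ α := by
  rw [intervalIntegral.integral_const_mul, integral_rpow (Or.inl (by linarith))]
  rw [sub_add_cancel]
  field_simp

/-- For `L` quasi-monotone with a finite limit and any `α > 0`, the increments of `u ^ α * L u`
are dominated by those of a monotone function `U` of order `u ^ α`. With `V` the variation function
of `L` and `M` a bound of `|L|`, the function `U u = u ^ α V(u) - ∫_a^u V(w) d(w ^ α) + M u ^ α`,
an integral of `w ^ α` against `dV` written by parts, does this. -/
lemma IsQuasiMonotone.exists_dominating {a c α : ℝ} {L : ℝ → ℝ} (ha : 0 < a) (hα : 0 < α)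
    (h : IsQuasiMonotone a L) (hc : Tendsto L atTop (𝓝 c)) :
    ∃ (M K : ℝ) (U : ℝ → ℝ), 0 ≤ M ∧ 0 ≤ K ∧ (∀ u, a < u → |L u| ≤ M) ∧
      (∀ u, a < u → 0 ≤ U u ∧ U u ≤ K * u ^ α) ∧
      ∀ v u, a < v → v ≤ u → |L u * u ^ α - L v * v ^ α| ≤ U u - U v := by
  obtain ⟨D, hD, hdy⟩ := h.exists_dyadic_bound ha hc
  obtain ⟨hL, -⟩ := h.quasi
  set V := variationFun a L with hV
  have hmono : Monotone V := variationFun_mono hL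
  obtain ⟨E, hE, hgrow⟩ := exists_sub_le_mul_div_rpow hmono hD (half_pos hα) hdy
  have hVi : ∀ v u, 0 < v → v ≤ u →
      IntervalIntegrable (fun w => V w * (α * w ^ (α - 1))) volume v u := by
    intro v u hv hvu
    refine (hmono.intervalIntegrable).mul_continuousOn (ContinuousOn.mul continuousOn_const ?_)
    rw [uIcc_of_le hvu]
    exact fun w hw => (continuousAt_rpow_const _ _ (Or.inl (hv.trans_le hw.1).ne')).continuousWithinAt
  have hPi : ∀ v u : ℝ, IntervalIntegrable (fun w => α * w ^ (α - 1)) volume v u := fun v u =>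
    (intervalIntegral.intervalIntegrable_rpow' (by linarith)).const_mul α
  -- Near infinity `|L|` is bounded by its limit, and elsewhere by its variation.
  obtain ⟨M, hM0, hM⟩ : ∃ M, 0 ≤ M ∧ ∀ u, a < u → |L u| ≤ M := by
    have hev : ∀ᶠ u in atTop, |L u| < |c| + 1 := hc.abs.eventually_lt_const (by linarith)
    obtain ⟨x0, hx0⟩ := (hev.and (eventually_gt_atTop a)).exists_forall_of_atTop
    refine ⟨|c| + 1 + V x0, by have := variationFun_nonneg a L x0; positivity, fun u hu => ?_⟩
    have hVx := variationFun_nonneg a L x0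
    rcases le_total x0 u with hxu | hxu
    · linarith [(hx0 u hxu).1]
    · have h1 := abs_sub_le_variationFun_sub hL hu hxu
      have h2 := (hx0 x0 le_rfl).1
      have h3 := abs_sub_abs_le_abs_sub (L u) (L x0)
      rw [abs_sub_comm] at h3
      have h4 := variationFun_nonneg a L u
      linarith
  refine ⟨M, E + 2 * E + M,
    fun u => u ^ α * V u - (∫ w in a..u, V w * (α * w ^ (α - 1))) + M * u ^ α,
    hM0, by positivity, hM, fun u hu => ?_, fun v u hv hvu => ?_⟩
  · have hu0 : 0 < u := ha.trans hu
    have hVu := variationFun_nonneg a L u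
    -- `U u` is rewritten with the increments `V u - V w`, which `hgrow` controls.
    have hrep : u ^ α * V u - (∫ w in a..u, V w * (α * w ^ (α - 1)))
        = a ^ α * V u + ∫ w in a..u, (V u - V w) * (α * w ^ (α - 1)) := by
      simp only [sub_mul]
      rw [intervalIntegral.integral_sub ((hPi a u).const_mul _) (hVi a u ha hu.le),
        intervalIntegral.integral_const_mul, integral_mul_rpow_sub_one hα]
      ring
    have hpos : 0 ≤ ∫ w in a..u, (V u - V w) * (α * w ^ (α - 1)) := by
      refine intervalIntegral.integral_nonneg hu.le fun w hw => ?_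
      have : 0 < w := ha.trans_le hw.1
      exact mul_nonneg (sub_nonneg.2 (hmono hw.2)) (by positivity)
    have hle : ∫ w in a..u, (V u - V w) * (α * w ^ (α - 1)) ≤ 2 * E * u ^ α := by
      calc _ ≤ ∫ w in a..u, (2 * E * u ^ (α / 2)) * ((α / 2) * w ^ (α / 2 - 1)) := by
            refine intervalIntegral.integral_mono_on hu.le ?_ ?_ fun w hw => ?_
            · simp only [sub_mul]
              exact ((hPi a u).const_mul _).sub (hVi a u ha hu.le)
            · exact ((intervalIntegral.intervalIntegrable_rpow' (by linarith)).const_mul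
                _).const_mul _
            · have hw0 : 0 < w := ha.trans_le hw.1
              have h1 := hgrow w u hw0 hw.2
              have h2 : (u / w) ^ (α / 2) * w ^ (α - 1) = u ^ (α / 2) * w ^ (α / 2 - 1) := by
                rw [div_rpow hu0.le hw0.le, div_mul_eq_mul_div, mul_div_assoc, ← rpow_sub hw0]
                ring_nf
              calc (V u - V w) * (α * w ^ (α - 1))
                  ≤ (E * (u / w) ^ (α / 2)) * (α * w ^ (α - 1)) := by gcongr
                _ = E * α * ((u / w) ^ (α / 2) * w ^ (α - 1)) := by ring
                _ = _ := by rw [h2]; ring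
        _ = 2 * E * (u ^ (α / 2) * u ^ (α / 2) - u ^ (α / 2) * a ^ (α / 2)) := by
            rw [intervalIntegral.integral_const_mul, integral_mul_rpow_sub_one (half_pos hα)]
            ring
        _ ≤ 2 * E * (u ^ (α / 2) * u ^ (α / 2)) := by
            have : 0 ≤ u ^ (α / 2) * a ^ (α / 2) := by positivity
            gcongr
            linarith
        _ = 2 * E * u ^ α := by rw [← rpow_add hu0, add_halves]
    have hV1 : a ^ α * V u ≤ E * u ^ α := by
      have h1 := hgrow a u ha hu.le
      rw [hV, variationFun_self, ← hV, sub_zero] at h1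
      have h2 : (u / a) ^ (α / 2) ≤ (u / a) ^ α :=
        rpow_le_rpow_of_exponent_le ((one_le_div ha).2 hu.le) (by linarith)
      calc a ^ α * V u ≤ a ^ α * (E * (u / a) ^ α) := by gcongr; exact h1.trans (by gcongr)
        _ = E * u ^ α := by
          rw [div_rpow hu0.le ha.le]
          have : 0 < a ^ α := by positivity
          field_simp
    have hua : 0 ≤ u ^ α := by positivity
    have haV : 0 ≤ a ^ α * V u := mul_nonneg (by positivity) hVu
    constructor
    · beta_reduce
      rw [hrep]; positivity
    · beta_reduce
      rw [hrep]; linarith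
  · have hv0 : 0 < v := ha.trans hv
    have hu0 : 0 < u := hv0.trans_le hvu
    have hsplit : (∫ w in a..u, V w * (α * w ^ (α - 1)))
        = (∫ w in a..v, V w * (α * w ^ (α - 1))) + ∫ w in v..u, V w * (α * w ^ (α - 1)) :=
      (intervalIntegral.integral_add_adjacent_intervals (hVi a v ha hv.le) (hVi v u hv0 hvu)).symm
    have hle : ∫ w in v..u, V w * (α * w ^ (α - 1)) ≤ V u * (u ^ α - v ^ α) := by
      rw [← integral_mul_rpow_sub_one hα, ← intervalIntegral.integral_const_mul]
      refine intervalIntegral.integral_mono_on hvu (hVi v u hv0 hvu) ((hPi v u).const_mul _)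
        fun w hw => ?_
      have : 0 < w := hv0.trans_le hw.1
      have := hmono hw.2
      gcongr
    have h1 := abs_sub_le_variationFun_sub hL hv hvu
    have h2 := hM u (hv.trans_le hvu)
    have h3 : v ^ α ≤ u ^ α := rpow_le_rpow hv0.le hvu hα.le
    have h4 : 0 ≤ v ^ α := by positivity
    -- By `hle`, `U u - U v` contains `(V u - V v) * v ^ α`, so the variation is to be weighted
    -- with the left end.
    have h5 : |L u * u ^ α - L v * v ^ α| ≤ M * (u ^ α - v ^ α) + (V u - V v) * v ^ α := by
      rw [show L u * u ^ α - L v * v ^ α = L u * (u ^ α - v ^ α) + (L u - L v) * v ^ α by ring]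
      refine (abs_add_le _ _).trans ?_
      rw [abs_mul, abs_mul, abs_of_nonneg (sub_nonneg.2 h3), abs_of_nonneg h4]
      gcongr
    simp only [hsplit]
    nlinarith

/-! ### One-sided Fourier asymptotics -/

/-- The part of the oscillatory integral away from the singularity at `0` is of order
`s ^ (-α) / h`, uniformly in the cut-off `s`. -/
lemma IsQuasiMonotone.exists_norm_integral_tail_le {A c α : ℝ} {L : ℝ → ℝ} (hA : 0 < A)
    (hα : 0 < α) (hL : IsQuasiMonotone (1 / A) L) (hc : Tendsto L atTop (𝓝 c))
    (hint : IntegrableOn (fun x => L (1 / x) * x ^ (-α)) (Ioo 0 A)) :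
    ∃ B, 0 ≤ B ∧ ∀ h s, 0 < h → 0 < s → s < A →
      ‖∫ x in s..A, Complex.exp (Complex.I * (h * x : ℝ)) * ((L (1 / x) * x ^ (-α) : ℝ) : ℂ)‖
        ≤ π / h * (B * s ^ (-α)) := by
  obtain ⟨M, K, U, hM0, hK0, hM, hU, hLU⟩ := hL.exists_dominating (by positivity) hα hc
  refine ⟨K + M, by positivity, fun h s hh hs hsA => ?_⟩
  have hinv : ∀ x, 0 < x → x < A → 1 / A < 1 / x := fun x hx hxA => one_div_lt_one_div_of_lt hx hxA
  have hpow : ∀ x : ℝ, 0 < x → (1 / x) ^ α = x ^ (-α) := fun x hx => by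
    rw [one_div, inv_rpow hx.le, rpow_neg hx.le]
  -- Cutting off at `A` adds a jump of `F`, which the term `M * x ^ (-α)` of `W` absorbs.
  set F : ℝ → ℝ := (Iio A).indicator fun x => L (1 / x) * x ^ (-α) with hF
  set W : ℝ → ℝ := (Iio A).indicator fun x => U (1 / x) + M * x ^ (-α) with hW
  have hF1 : ∀ x, x < A → F x = L (1 / x) * x ^ (-α) := fun x hx => indicator_of_mem (mem_Iio.2 hx) _
  have hF2 : ∀ x, A ≤ x → F x = 0 := fun x hx => indicator_of_notMem (by simpa using hx) _
  have hW1 : ∀ x, x < A → W x = U (1 / x) + M * x ^ (-α) := fun x hx =>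
    indicator_of_mem (mem_Iio.2 hx) _
  have hW2 : ∀ x, A ≤ x → W x = 0 := fun x hx => indicator_of_notMem (by simpa using hx) _
  have hFW0 : ∀ x, s ≤ x → |F x| ≤ W x := by
    intro x hx
    have hx0 := hs.trans_le hx
    rcases lt_or_ge x A with hxA | hxA
    · rw [hF1 x hxA, hW1 x hxA, abs_mul, abs_of_nonneg (rpow_nonneg hx0.le _)]
      have h1 := hM _ (hinv x hx0 hxA)
      have h2 := (hU _ (hinv x hx0 hxA)).1
      have h3 : 0 ≤ x ^ (-α) := rpow_nonneg hx0.le _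
      nlinarith
    · rw [hF2 x hxA, hW2 x hxA, abs_zero]
  have hFW : ∀ x y, s ≤ x → x ≤ y → |F x - F y| ≤ W x - W y := by
    intro x y hx hxy
    have hx0 := hs.trans_le hx
    rcases lt_or_ge y A with hyA | hyA
    · have hxA := hxy.trans_lt hyA
      have hy0 := hx0.trans_le hxy
      have h1 := hLU (1 / y) (1 / x) (hinv y hy0 hyA) (one_div_le_one_div_of_le hx0 hxy)
      have h2 : y ^ (-α) ≤ x ^ (-α) := rpow_le_rpow_of_nonpos hx0 hxy (by linarith)
      rw [hpow x hx0, hpow y hy0] at h1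
      rw [hF1 x hxA, hW1 x hxA, hF1 y hyA, hW1 y hyA]
      nlinarith
    · rw [hF2 y hyA, hW2 y hyA, sub_zero, sub_zero]
      exact hFW0 x hx
  have hsplit : Ioi s ∩ Iio A = Ioo s A := Ioi_inter_Iio
  have hFi : IntegrableOn F (Ioi s) := by
    rw [hF, IntegrableOn, integrable_indicator_iff measurableSet_Iio, IntegrableOn,
      Measure.restrict_restrict measurableSet_Iio, inter_comm, hsplit]
    exact hint.mono_set (Ioo_subset_Ioo_left hs.le)
  have key := norm_integral_exp_mul_le hh hFi hFW hFW0
  have heq : ∫ x in Ioi s, Complex.exp (Complex.I * (h * x : ℝ)) * (F x : ℂ)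
      = ∫ x in s..A, Complex.exp (Complex.I * (h * x : ℝ)) * ((L (1 / x) * x ^ (-α) : ℝ) : ℂ) := by
    have : (fun x : ℝ => Complex.exp (Complex.I * (h * x : ℝ)) * (F x : ℂ))
        = (Iio A).indicator fun x : ℝ =>
          Complex.exp (Complex.I * (h * x : ℝ)) * ((L (1 / x) * x ^ (-α) : ℝ) : ℂ) := by
      funext x
      rcases lt_or_ge x A with hxA | hxA
      · rw [hF1 x hxA, indicator_of_mem (mem_Iio.2 hxA)]
      · rw [hF2 x hxA, indicator_of_notMem (by simpa using hxA)]; simp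
    rw [this, setIntegral_indicator measurableSet_Iio, hsplit,
      intervalIntegral.integral_of_le hsA.le, integral_Ioc_eq_integral_Ioo]
  rw [← heq]
  refine key.trans ?_
  have : W s ≤ (K + M) * s ^ (-α) := by
    rw [hW1 s hsA, add_mul, ← hpow s hs]
    have := (hU _ (hinv s hs hsA)).2
    linarith
  gcongr

/-- Substitution `x = y / h` in the model integral. -/
lemma rpow_mul_integral_exp_mul_rpow {α h T : ℝ} (hh : 0 < h) (hT : 0 < T) :
    ((h ^ (1 - α) : ℝ) : ℂ) *
        ∫ x in (0 : ℝ)..T / h, Complex.exp (Complex.I * (h * x : ℝ)) * ((x ^ (-α) : ℝ) : ℂ)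
      = ∫ y in (0 : ℝ)..T, Complex.exp (Complex.I * y) * ((y ^ (-α) : ℝ) : ℂ) := by
  have h1 := intervalIntegral.integral_comp_div (a := 0) (b := T)
    (fun x : ℝ => Complex.exp (Complex.I * (h * x : ℝ)) * ((x ^ (-α) : ℝ) : ℂ)) hh.ne'
  have h2 : ∫ y in (0 : ℝ)..T, Complex.exp (Complex.I * (h * (y / h) : ℝ)) * (((y / h) ^ (-α) : ℝ) : ℂ)
      = ((h ^ α : ℝ) : ℂ) * ∫ y in (0 : ℝ)..T, Complex.exp (Complex.I * y) * ((y ^ (-α) : ℝ) : ℂ) := by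
    rw [← intervalIntegral.integral_const_mul]
    refine intervalIntegral.integral_congr fun y hy => ?_
    rw [uIcc_of_le hT.le] at hy
    rw [div_rpow hy.1 hh.le, mul_div_cancel₀ _ hh.ne', rpow_neg hh.le, div_inv_eq_mul]
    push_cast; ring
  rw [h2, zero_div] at h1
  have h3 : ((h ^ (1 - α) : ℝ) : ℂ) = ((h ^ α : ℝ) : ℂ)⁻¹ * (h : ℂ) := by
    rw [rpow_sub hh, rpow_one]; push_cast; rw [div_eq_inv_mul]
  have h4 : ((h ^ α : ℝ) : ℂ) ≠ 0 := by
    have : 0 < h ^ α := by positivity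
    exact_mod_cast this.ne'
  rw [h3, mul_assoc]
  rw [Complex.real_smul] at h1
  rw [← h1, inv_mul_cancel_left₀ h4]

/-- The one-sided Fourier asymptotics at an algebraic singularity `L(1/x) x ^ (-α)`. The integral
is cut at `T / h`: below, `L(1/x)` may be replaced by its limit, and the tail is of order
`T ^ (-α)` after scaling. -/
lemma IsQuasiMonotone.tendsto_rpow_mul_integral {A c α : ℝ} {L : ℝ → ℝ} (hA : 0 < A)
    (hα : 0 < α) (hα1 : α < 1) (hL : IsQuasiMonotone (1 / A) L) (hc : Tendsto L atTop (𝓝 c))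
    (hint : IntegrableOn (fun x => L (1 / x) * x ^ (-α)) (Ioo 0 A)) :
    Tendsto (fun h : ℝ => ((h ^ (1 - α) : ℝ) : ℂ) *
        ∫ x in (0 : ℝ)..A, Complex.exp (Complex.I * (h * x : ℝ)) * ((L (1 / x) * x ^ (-α) : ℝ) : ℂ))
      atTop (𝓝 (c * (Gamma (1 - α) * Complex.exp (Complex.I * (π * (1 - α) / 2 : ℝ))))) := by
  obtain ⟨B, hB0, hB⟩ := hL.exists_norm_integral_tail_le hA hα hc hint
  rw [Metric.tendsto_nhds]
  intro ε hε
  obtain ⟨T, hT0, hTε⟩ : ∃ T : ℝ, 0 < T ∧ (π * B + |c| * π) * T ^ (-α) < ε / 2 := by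
    have h1 : Tendsto (fun T : ℝ => (π * B + |c| * π) * T ^ (-α)) atTop (𝓝 0) := by
      simpa using (tendsto_rpow_neg_atTop hα).const_mul (π * B + |c| * π)
    obtain ⟨T, h1, h2⟩ := ((h1.eventually_lt_const (half_pos hε)).and (eventually_gt_atTop 0)).exists
    exact ⟨T, h2, h1⟩
  -- `η` bounds `|L(1/x) - c|` on `(0, T / h)`, and `∫₀^T y ^ (-α) dy = T ^ (1 - α) / (1 - α)`.
  set η := ε / 2 * (1 - α) / T ^ (1 - α) with hη
  have hη0 : 0 < η := by have : 0 < 1 - α := by linarith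
                         positivity
  obtain ⟨u0, hu0⟩ := eventually_atTop.1 (Metric.tendsto_nhds.1 hc η hη0)
  filter_upwards [eventually_gt_atTop (T / A), eventually_gt_atTop 0,
    eventually_ge_atTop (T * u0)] with h hhA hh hhu
  have hs0 : 0 < T / h := by positivity
  have hsA : T / h < A := by rw [div_lt_iff₀ hA] at hhA; rw [div_lt_iff₀ hh]; linarith
  set e : ℝ → ℂ := fun x => Complex.exp (Complex.I * (h * x : ℝ)) with he
  have hecont : Continuous e := by fun_prop
  have hnorm : ∀ x, ‖e x‖ = 1 := fun x => norm_cexp_I_mul_ofReal _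
  have hbdd : ∀ {g : ℝ → ℝ} {a b : ℝ}, IntervalIntegrable g volume a b →
      IntervalIntegrable (fun x => e x * (g x : ℂ)) volume a b := fun hg =>
    IntervalIntegrable.continuousOn_mul ⟨hg.1.ofReal, hg.2.ofReal⟩ hecont.continuousOn
  have hintA : IntervalIntegrable (fun x => L (1 / x) * x ^ (-α)) volume 0 A := by
    rw [intervalIntegrable_iff_integrableOn_Ioo_of_le hA.le]; exact hint
  have hint1 : IntervalIntegrable (fun x => L (1 / x) * x ^ (-α)) volume 0 (T / h) :=
    hintA.mono_set (by rw [uIcc_of_le hs0.le, uIcc_of_le hA.le]; exact Icc_subset_Icc_right hsA.le)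
  have hint2 : IntervalIntegrable (fun x => L (1 / x) * x ^ (-α)) volume (T / h) A :=
    hintA.mono_set (by rw [uIcc_of_le hsA.le, uIcc_of_le hA.le]; exact Icc_subset_Icc_left hs0.le)
  have hint3 : IntervalIntegrable (fun x : ℝ => x ^ (-α)) volume 0 (T / h) :=
    intervalIntegral.intervalIntegrable_rpow' (by linarith)
  have hsplit : ∫ x in (0 : ℝ)..A, e x * ((L (1 / x) * x ^ (-α) : ℝ) : ℂ)
      = (∫ x in (0 : ℝ)..T / h, e x * (((L (1 / x) - c) * x ^ (-α) : ℝ) : ℂ))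
        + c * (∫ x in (0 : ℝ)..T / h, e x * ((x ^ (-α) : ℝ) : ℂ))
        + ∫ x in T / h..A, e x * ((L (1 / x) * x ^ (-α) : ℝ) : ℂ) := by
    rw [← intervalIntegral.integral_add_adjacent_intervals (hbdd hint1) (hbdd hint2)]
    congr 1
    rw [← intervalIntegral.integral_const_mul, ← intervalIntegral.integral_add]
    · refine intervalIntegral.integral_congr fun x _ => ?_
      push_cast; ring
    · have : IntervalIntegrable (fun x => (L (1 / x) - c) * x ^ (-α)) volume 0 (T / h) := by
        simp only [sub_mul]
        exact hint1.sub (hint3.const_mul c)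
      exact hbdd this
    · exact (hbdd hint3).const_mul _
  have hscale : h ^ (1 - α) * (T / h) ^ (1 - α) = T ^ (1 - α) := by
    rw [← mul_rpow hh.le hs0.le, mul_div_cancel₀ _ hh.ne']
  have hhp : 0 < h ^ (1 - α) := by positivity
  have b1 : ‖((h ^ (1 - α) : ℝ) : ℂ) *
      ∫ x in (0 : ℝ)..T / h, e x * (((L (1 / x) - c) * x ^ (-α) : ℝ) : ℂ)‖ ≤ ε / 2 := by
    have h1 : ‖∫ x in (0 : ℝ)..T / h, e x * (((L (1 / x) - c) * x ^ (-α) : ℝ) : ℂ)‖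
        ≤ ∫ x in (0 : ℝ)..T / h, η * x ^ (-α) := by
      refine intervalIntegral.norm_integral_le_of_norm_le hs0.le
        (Eventually.of_forall fun x hx => ?_) (hint3.const_mul η)
      rw [norm_mul, hnorm, one_mul, Complex.norm_real, norm_eq_abs, abs_mul,
        abs_of_nonneg (rpow_nonneg hx.1.le _)]
      have hux : u0 ≤ 1 / x := by
        rw [le_div_iff₀ hx.1]
        have h2 : x * h ≤ T := (le_div_iff₀ hh).1 hx.2
        by_contra! h3
        have hu0 : 0 < u0 := by
          by_contra! h4
          nlinarith [hx.1]
        nlinarith [mul_le_mul_of_nonneg_right h2 hu0.le]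
      have := hu0 _ hux
      rw [Real.dist_eq] at this
      have hx0 : 0 ≤ x ^ (-α) := rpow_nonneg hx.1.le _
      gcongr
    rw [intervalIntegral.integral_const_mul, integral_rpow (Or.inl (by linarith)),
      zero_rpow (by linarith), sub_zero, neg_add_eq_sub] at h1
    rw [norm_mul, Complex.norm_real, norm_eq_abs, abs_of_pos hhp]
    have hT1 : 0 < T ^ (1 - α) := by positivity
    have h1α : 1 - α ≠ 0 := by linarith
    calc _ ≤ h ^ (1 - α) * (η * ((T / h) ^ (1 - α) / (1 - α))) := by gcongr
      _ = η * (h ^ (1 - α) * (T / h) ^ (1 - α)) / (1 - α) := by ring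
      _ = ε / 2 := by rw [hscale, hη]; field_simp
  have b2 : ‖((h ^ (1 - α) : ℝ) : ℂ) * (c * (∫ x in (0 : ℝ)..T / h, e x * ((x ^ (-α) : ℝ) : ℂ)))
      - c * (Gamma (1 - α) * Complex.exp (Complex.I * (π * (1 - α) / 2 : ℝ)))‖
      ≤ |c| * (π * T ^ (-α)) := by
    rw [mul_left_comm, rpow_mul_integral_exp_mul_rpow hh hT0, ← mul_sub, norm_mul,
      Complex.norm_real, norm_eq_abs]
    gcongr
    exact norm_integral_rpow_mul_exp_sub_le hα hα1 hT0
  have b3 : ‖((h ^ (1 - α) : ℝ) : ℂ) *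
      ∫ x in T / h..A, e x * ((L (1 / x) * x ^ (-α) : ℝ) : ℂ)‖ ≤ π * B * T ^ (-α) := by
    rw [norm_mul, Complex.norm_real, norm_eq_abs, abs_of_pos hhp]
    calc _ ≤ h ^ (1 - α) * (π / h * (B * (T / h) ^ (-α))) := by
          gcongr; exact hB h (T / h) hh hs0 hsA
      _ = π * B * T ^ (-α) := by
          rw [div_rpow hT0.le hh.le, rpow_sub hh, rpow_one, rpow_neg hh.le]
          have : 0 < h ^ α := by positivity
          field_simp
  rw [dist_eq_norm, hsplit, mul_add, mul_add]
  have hre : ∀ a b d k : ℂ, a + b + d - k = a + (b - k) + d := fun a b d k => by ring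
  rw [hre]
  refine (norm_add₃_le).trans_lt ?_
  linarith

/-! ### Evenness of the spectral density -/

/-- An integrable function on `(-π, π)` all of whose Fourier coefficients vanish is zero almost
everywhere: integration against it is a bounded functional on continuous functions on the circle
that kills the trigonometric polynomials, which are dense. -/
lemma ae_eq_zero_of_forall_integral_cexp_eq_zero {g : ℝ → ℂ} (hg : IntegrableOn g (Ioo (-π) π))
    (h : ∀ n : ℤ, ∫ l in (-π)..π, Complex.exp (Complex.I * (n : ℂ) * (l : ℂ)) * g l = 0) :
    ∀ᵐ l, l ∈ Ioo (-π) π → g l = 0 := by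
  have : Fact (0 < 2 * π) := ⟨two_pi_pos⟩
  have hg' : IntegrableOn g (Ioc (-π) π) := by rwa [integrableOn_Ioc_iff_integrableOn_Ioo]
  have hle : -π ≤ π := by linarith [pi_pos]
  have hint : ∀ k : C(AddCircle (2 * π), ℂ),
      IntegrableOn (fun l : ℝ => k (l : AddCircle (2 * π)) * g l) (Ioc (-π) π) := fun k => by
    refine Integrable.bdd_mul (c := ‖k‖) hg'
      (k.continuous.comp (AddCircle.continuous_mk' _)).aestronglyMeasurable ?_
    exact Eventually.of_forall fun l => k.norm_coe_le_norm _
  let Φ : C(AddCircle (2 * π), ℂ) →L[ℂ] ℂ := LinearMap.mkContinuous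
    { toFun := fun k => ∫ l in Ioc (-π) π, k (l : AddCircle (2 * π)) * g l
      map_add' := fun k k' => by
        simp only [ContinuousMap.add_apply, add_mul]
        exact integral_add (hint k) (hint k')
      map_smul' := fun c k => by
        simp only [ContinuousMap.smul_apply, smul_eq_mul, mul_assoc, RingHom.id_apply]
        exact integral_const_mul _ _ }
    (∫ l in Ioc (-π) π, ‖g l‖) fun k => by
      refine (norm_integral_le_of_norm_le (hg'.norm.const_mul ‖k‖)
        (Eventually.of_forall fun l => ?_)).trans_eq ?_
      · rw [norm_mul]
        gcongr
        exact k.norm_coe_le_norm _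
      · rw [integral_const_mul, mul_comm]
  have hΦ : ∀ k, Φ k = ∫ l in Ioc (-π) π, k (l : AddCircle (2 * π)) * g l := fun k => rfl
  have hfour : ∀ n : ℤ, Φ (fourier n) = 0 := fun n => by
    rw [hΦ, ← h n, intervalIntegral.integral_of_le hle]
    refine integral_congr_ae (Eventually.of_forall fun l => ?_)
    beta_reduce
    rw [fourier_coe_apply]
    congr 2
    have : (π : ℂ) ≠ 0 := by exact_mod_cast pi_ne_zero
    push_cast
    field_simp
  have hzero : ∀ k, Φ k = 0 := by
    have h1 : Submodule.span ℂ (range (@fourier (2 * π))) ≤ LinearMap.ker (Φ : _ →ₗ[ℂ] ℂ) := by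
      rw [Submodule.span_le]
      rintro _ ⟨n, rfl⟩
      exact hfour n
    have h2 := Submodule.topologicalClosure_minimal _ h1 (ContinuousLinearMap.isClosed_ker Φ)
    rw [span_fourier_closure_eq_top] at h2
    exact fun k => h2 (Submodule.mem_top (x := k))
  refine isOpen_Ioo.ae_eq_zero_of_integral_contDiff_smul_eq_zero hg.locallyIntegrableOn
    fun φ hφ _ hsupp => ?_
  have hφ0 : ∀ x, x ∉ Ioo (-π) π → φ x = 0 := fun x hx =>
    image_eq_zero_of_notMem_tsupport fun hx' => hx (hsupp hx')
  let k : C(AddCircle (2 * π), ℂ) :=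
    ⟨AddCircle.liftIoc (2 * π) (-π) fun x => (φ x : ℂ), AddCircle.liftIoc_continuous
      (by rw [hφ0 _ (by simp), hφ0 (-π + 2 * π) (by simp; intro; linarith)])
      (Complex.continuous_ofReal.comp hφ.continuous).continuousOn⟩
  rw [← hzero k, hΦ, ← setIntegral_eq_integral_of_forall_compl_eq_zero (s := Ioc (-π) π)]
  · refine setIntegral_congr_fun measurableSet_Ioc fun x hx => ?_
    have : k (x : AddCircle (2 * π)) = (φ x : ℂ) :=
      AddCircle.liftIoc_coe_apply (f := fun x => (φ x : ℂ))
        (by rwa [show -π + 2 * π = π by ring])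
    rw [this, Complex.real_smul]
  · intro x hx
    rw [hφ0 x fun hx' => hx (Ioo_subset_Ioc_self hx'), zero_smul]

lemma IsSpectralDensity.intervalIntegrable {γ : ℤ → ℝ} {f : ℝ → ℝ} (hf : IsSpectralDensity γ f)
    {p q : ℝ} (hp : -π ≤ p) (hpq : p ≤ q) (hq : q ≤ π) : IntervalIntegrable f volume p q := by
  rw [intervalIntegrable_iff_integrableOn_Ioo_of_le hpq]
  exact hf.integrableOn.mono_set (Ioo_subset_Ioo hp hq)

lemma IntervalIntegrable.cexp_mul_ofReal {f : ℝ → ℝ} {p q : ℝ} (hf : IntervalIntegrable f volume p q)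
    (h : ℂ) : IntervalIntegrable
      (fun l : ℝ => Complex.exp (Complex.I * h * (l : ℂ)) * ((f l : ℝ) : ℂ)) volume p q :=
  IntervalIntegrable.continuousOn_mul ⟨hf.1.ofReal, hf.2.ofReal⟩
    (Continuous.continuousOn (by fun_prop))

/-- The spectral density of an even autocovariance function is even almost everywhere. -/
lemma IsSpectralDensity.ae_even {γ : ℤ → ℝ} {f : ℝ → ℝ} (hf : IsSpectralDensity γ f)
    (hγ : ∀ h, γ (-h) = γ h) : ∀ᵐ l, l ∈ Ioo (-π) π → f (-l) = f l := by
  have hle : -π ≤ π := by linarith [pi_pos]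
  have hi := hf.intervalIntegrable le_rfl hle le_rfl
  have hin : IntervalIntegrable (fun l => f (-l)) volume (-π) π := by
    simpa using (IntervalIntegrable.iff_comp_neg (f := f) (a := -π) (b := π)).1 hi |>.symm
  have key := ae_eq_zero_of_forall_integral_cexp_eq_zero (g := fun l => ((f l - f (-l) : ℝ) : ℂ)) ?_ ?_
  · filter_upwards [key] with l hl hmem
    have h1 : f l - f (-l) = 0 := by exact_mod_cast hl hmem
    linarith
  · have := (hi.sub hin)
    rw [intervalIntegrable_iff_integrableOn_Ioo_of_le hle] at this
    exact this.ofReal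
  · intro n
    have h1 : ∫ l in (-π)..π, Complex.exp (Complex.I * (n : ℂ) * (l : ℂ)) * ((f (-l) : ℝ) : ℂ)
        = ((γ (-n) : ℝ) : ℂ) := by
      rw [hf.fourier (-n)]
      have := intervalIntegral.integral_comp_neg (a := -π) (b := π)
        (fun l : ℝ => Complex.exp (Complex.I * ((-n : ℤ) : ℂ) * (l : ℂ)) * ((f l : ℝ) : ℂ))
      rw [neg_neg] at this
      rw [← this]
      refine intervalIntegral.integral_congr fun l _ => ?_
      congr 2
      push_cast; ring
    have h2 : ∀ l : ℝ, Complex.exp (Complex.I * (n : ℂ) * (l : ℂ)) * ((f l - f (-l) : ℝ) : ℂ)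
        = Complex.exp (Complex.I * (n : ℂ) * (l : ℂ)) * ((f l : ℝ) : ℂ)
          - Complex.exp (Complex.I * (n : ℂ) * (l : ℂ)) * ((f (-l) : ℝ) : ℂ) := fun l => by
      push_cast; ring
    simp only [h2]
    rw [intervalIntegral.integral_sub (hi.cexp_mul_ofReal _) (hin.cexp_mul_ofReal _), h1,
      ← hf.fourier n, hγ, sub_self]

lemma IsSpectralDensity.eq_two_mul_re {γ : ℤ → ℝ} {f : ℝ → ℝ} (hf : IsSpectralDensity γ f)
    (hγ : ∀ h, γ (-h) = γ h) (h : ℤ) :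
    γ h = 2 * (∫ l in (0 : ℝ)..π, Complex.exp (Complex.I * (h : ℂ) * (l : ℂ)) * ((f l : ℝ) : ℂ)).re := by
  have hpi := pi_pos
  have h0 := hf.fourier h
  rw [← intervalIntegral.integral_add_adjacent_intervals (b := 0)
    ((hf.intervalIntegrable le_rfl (by linarith) (by linarith)).cexp_mul_ofReal _)
    ((hf.intervalIntegrable (by linarith) (by linarith) le_rfl).cexp_mul_ofReal _)] at h0
  set z := ∫ l in (0 : ℝ)..π, Complex.exp (Complex.I * (h : ℂ) * (l : ℂ)) * ((f l : ℝ) : ℂ) with hz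
  have h1 : ∫ l in (-π)..0, Complex.exp (Complex.I * (h : ℂ) * (l : ℂ)) * ((f l : ℝ) : ℂ)
      = (starRingEnd ℂ) z := by
    rw [hz, intervalIntegral.integral_of_le hpi.le, ← integral_conj,
      ← intervalIntegral.integral_of_le hpi.le]
    have := intervalIntegral.integral_comp_neg (a := 0) (b := π)
        (fun l : ℝ => Complex.exp (Complex.I * (h : ℂ) * (l : ℂ)) * ((f l : ℝ) : ℂ))
    rw [neg_zero] at this
    rw [← this]
    refine intervalIntegral.integral_congr_ae ?_
    filter_upwards [hf.ae_even hγ, Measure.ae_ne volume π] with l hl hlpi hmem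
    rw [uIoc_of_le hpi.le] at hmem
    rw [hl ⟨by linarith [hmem.1], lt_of_le_of_ne hmem.2 hlpi⟩, map_mul, Complex.conj_ofReal,
      ← Complex.exp_conj]
    simp
  rw [h1, add_comm, Complex.add_conj] at h0
  exact_mod_cast h0

/-! ### The constant and the phase -/

lemma clmModulus_sq (d cm cp : ℝ) : clmModulus d cm cp ^ 2
    = ((cp + cm) * sin (π * d)) ^ 2 + ((cp - cm) * cos (π * d)) ^ 2 := by
  have h : cp ^ 2 + cm ^ 2 - 2 * cp * cm * cos (2 * π * d)
      = ((cp + cm) * sin (π * d)) ^ 2 + ((cp - cm) * cos (π * d)) ^ 2 := by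
    rw [mul_assoc 2 π d, cos_two_mul]
    linear_combination (-(cp + cm) ^ 2) * sin_sq_add_cos_sq (π * d)
  rw [clmModulus, h, sq_sqrt (by positivity)]

lemma sin_pi_mul_pos {d : ℝ} (hd : d ∈ Ioo (0 : ℝ) (1 / 2)) : 0 < sin (π * d) :=
  sin_pos_of_pos_of_lt_pi (mul_pos pi_pos hd.1) (by nlinarith [pi_pos, hd.2])

lemma cos_pi_mul_pos {d : ℝ} (hd : d ∈ Ioo (0 : ℝ) (1 / 2)) : 0 < cos (π * d) :=
  cos_pos_of_mem_Ioo ⟨by nlinarith [pi_pos, hd.1], by nlinarith [pi_pos, hd.2]⟩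

lemma abs_sub_lt_clmModulus {d cm cp : ℝ} (hd : d ∈ Ioo (0 : ℝ) (1 / 2)) (hcm : 0 < cm)
    (hcp : 0 < cp) : |cp - cm| < clmModulus d cm cp := by
  refine abs_lt_of_sq_lt_sq ?_ (sqrt_nonneg _)
  have h1 := mul_pos (mul_pos hcm hcp) (pow_pos (sin_pi_mul_pos hd) 2)
  have h2 := sin_sq_add_cos_sq (π * d)
  rw [clmModulus_sq]
  nlinarith

lemma clmModulus_pos {d cm cp : ℝ} (hd : d ∈ Ioo (0 : ℝ) (1 / 2)) (hcm : 0 < cm) (hcp : 0 < cp) :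
    0 < clmModulus d cm cp :=
  (abs_nonneg _).trans_lt (abs_sub_lt_clmModulus hd hcm hcp)

lemma abs_div_clmModulus_lt {d cm cp : ℝ} (hd : d ∈ Ioo (0 : ℝ) (1 / 2)) (hcm : 0 < cm)
    (hcp : 0 < cp) : |(cp - cm) * cos (π * d) / clmModulus d cm cp| < cos (π * d) := by
  have hM := clmModulus_pos hd hcm hcp
  have hc := cos_pi_mul_pos hd
  rw [abs_div, abs_mul, abs_of_pos hc, abs_of_pos hM, div_lt_iff₀ hM, mul_comm]
  exact mul_lt_mul_of_pos_left (abs_sub_lt_clmModulus hd hcm hcp) hc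

lemma clmModulus_mul_sin_clmPhase {d cm cp : ℝ} (hd : d ∈ Ioo (0 : ℝ) (1 / 2)) (hcm : 0 < cm)
    (hcp : 0 < cp) :
    clmModulus d cm cp * sin (clmPhase d cm cp) = (cp - cm) * cos (π * d) := by
  have h := abs_le.1 ((abs_div_clmModulus_lt hd hcm hcp).le.trans (cos_le_one _))
  rw [clmPhase, sin_arcsin h.1 h.2, mul_div_cancel₀ _ (clmModulus_pos hd hcm hcp).ne']

lemma clmModulus_mul_cos_clmPhase {d cm cp : ℝ} (hd : d ∈ Ioo (0 : ℝ) (1 / 2)) (hcm : 0 < cm)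
    (hcp : 0 < cp) :
    clmModulus d cm cp * cos (clmPhase d cm cp) = (cp + cm) * sin (π * d) := by
  have h1 := clmModulus_mul_sin_clmPhase hd hcm hcp
  have h2 := clmModulus_sq d cm cp
  have h3 := sin_sq_add_cos_sq (clmPhase d cm cp)
  have h4 : 0 ≤ cos (clmPhase d cm cp) := cos_arcsin_nonneg _
  refine (pow_left_inj₀ (mul_nonneg (clmModulus_pos hd hcm hcp).le h4)
    (mul_nonneg (by linarith) (sin_pi_mul_pos hd).le) two_ne_zero).1 ?_
  rw [← h1] at h2
  linear_combination h2 + (-(clmModulus d cm cp) ^ 2 + 2 * clmModulus d cm cp ^ 2) * h3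

lemma clmPhase_mem {d cm cp : ℝ} (hd : d ∈ Ioo (0 : ℝ) (1 / 2)) (hcm : 0 < cm)
    (hcp : 0 < cp) :
    clmPhase d cm cp ∈ Ioo (-((1 / 2 - d) * π)) ((1 / 2 - d) * π) := by
  have hpi := pi_pos
  have h := abs_div_clmModulus_lt hd hcm hcp
  have hle := abs_le.1 (h.le.trans (cos_le_one _))
  have hs : sin ((1 / 2 - d) * π) = cos (π * d) := by
    rw [show (1 / 2 - d) * π = π / 2 - π * d by ring, sin_pi_div_two_sub]
  rw [abs_lt] at h
  have hm : (1 / 2 - d) * π ∈ Icc (-(π / 2)) (π / 2) :=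
    ⟨by nlinarith [hd.1, hd.2], by nlinarith [hd.1, hd.2]⟩
  refine ⟨?_, ?_⟩
  · rw [clmPhase, lt_arcsin_iff_sin_lt ⟨by linarith [hm.2], by linarith [hm.1]⟩ hle, sin_neg, hs]
    exact h.1
  · rw [clmPhase, arcsin_lt_iff_lt_sin hle hm, hs]
    exact h.2

/-- The contributions of the two sides of the cyclical frequency add up to a complex number with
modulus and argument given by `clmConst` and `clmPhase`. -/
lemma two_mul_re_cexp_mul_eq {d cm cp : ℝ} (hd : d ∈ Ioo (0 : ℝ) (1 / 2)) (hcm : 0 < cm)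
    (hcp : 0 < cp) (x : ℝ) :
    2 * (Complex.exp (Complex.I * (x : ℂ)) *
      ((starRingEnd ℂ) (cm * (Gamma (1 - 2 * d) *
          Complex.exp (Complex.I * (π * (1 - 2 * d) / 2 : ℝ))))
        + cp * (Gamma (1 - 2 * d) * Complex.exp (Complex.I * (π * (1 - 2 * d) / 2 : ℝ))))).re
      = clmConst d cm cp * cos (x + clmPhase d cm cp) := by
  have h1 := clmModulus_mul_sin_clmPhase hd hcm hcp
  have h2 := clmModulus_mul_cos_clmPhase hd hcm hcp
  have hexp : ∀ t : ℝ, Complex.exp (Complex.I * (t : ℂ)) = (cos t : ℂ) + (sin t : ℂ) * Complex.I :=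
    fun t => by rw [mul_comm, Complex.exp_mul_I, Complex.ofReal_cos, Complex.ofReal_sin]
  have hc : cos (π * (1 - 2 * d) / 2) = sin (π * d) := by
    rw [show π * (1 - 2 * d) / 2 = π / 2 - π * d by ring, cos_pi_div_two_sub]
  have hs : sin (π * (1 - 2 * d) / 2) = cos (π * d) := by
    rw [show π * (1 - 2 * d) / 2 = π / 2 - π * d by ring, sin_pi_div_two_sub]
  rw [hexp, hexp, hc, hs, clmConst, cos_add]
  simp only [Complex.mul_re, Complex.add_re, Complex.add_im, Complex.mul_im, Complex.conj_re,
    Complex.conj_im, Complex.ofReal_re, Complex.ofReal_im, Complex.I_re, Complex.I_im]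
  linear_combination (-2 * Gamma (1 - 2 * d) * cos x) * h2 + (2 * Gamma (1 - 2 * d) * sin x) * h1

/-! ### Asymptotics of the autocovariances -/

lemma acvf_neg {Ω : Type*} [MeasurableSpace Ω] {P : Measure Ω} {X : ℤ → Ω → ℝ}
    (hX : IsSecondOrderStationary P X) (h : ℤ) : acvf P X (-h) = acvf P X h := by
  have := hX.cov_shift (-h) h
  rw [neg_add_cancel] at this
  rw [acvf, acvf, ← this, covariance_comm]

/-- The integral over `(0, π)` recentred at `lam0` on both of its sides. -/
lemma integral_cexp_mul_eq_recentred {f Fm Fp : ℝ → ℝ} {lam0 : ℝ} (hl : lam0 ∈ Ioo 0 π)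
    (hf : IntervalIntegrable f volume 0 π)
    (hm : ∀ x, 0 < x → x < lam0 → f (lam0 - x) = Fm x)
    (hp : ∀ x, 0 < x → x < π - lam0 → f (lam0 + x) = Fp x) (h : ℝ) :
    ∫ l in (0 : ℝ)..π, Complex.exp (Complex.I * (h : ℂ) * (l : ℂ)) * ((f l : ℝ) : ℂ)
      = Complex.exp (Complex.I * (lam0 * h : ℝ)) *
        ((starRingEnd ℂ) (∫ x in (0 : ℝ)..lam0, Complex.exp (Complex.I * (h * x : ℝ)) * (Fm x : ℂ))
          + ∫ x in (0 : ℝ)..π - lam0, Complex.exp (Complex.I * (h * x : ℝ)) * (Fp x : ℂ)) := by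
  have hl0 := hl.1
  have hl1 := hl.2
  have hsub : 0 < π - lam0 := sub_pos.2 hl1
  rw [← intervalIntegral.integral_add_adjacent_intervals (b := lam0)
    (IntervalIntegrable.cexp_mul_ofReal (hf.mono_set (by
      rw [uIcc_of_le hl0.le, uIcc_of_le pi_pos.le]; exact Icc_subset_Icc_right hl1.le)) _)
    (IntervalIntegrable.cexp_mul_ofReal (hf.mono_set (by
      rw [uIcc_of_le hl1.le, uIcc_of_le pi_pos.le]; exact Icc_subset_Icc_left hl0.le)) _), mul_add]
  congr 1
  · have h1 := intervalIntegral.integral_comp_sub_left (a := 0) (b := lam0)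
      (fun l : ℝ => Complex.exp (Complex.I * (h : ℂ) * (l : ℂ)) * ((f l : ℝ) : ℂ)) lam0
    rw [sub_self, sub_zero] at h1
    rw [← h1]
    simp only [intervalIntegral.integral_of_le hl0.le]
    rw [← integral_conj, ← integral_const_mul]
    refine setIntegral_congr_ae measurableSet_Ioc ?_
    filter_upwards [Measure.ae_ne volume lam0] with x hx hmem
    rw [hm x hmem.1 (lt_of_le_of_ne hmem.2 hx), map_mul, Complex.conj_ofReal, ← Complex.exp_conj,
      ← mul_assoc, ← Complex.exp_add]
    congr 2
    simp only [map_mul, Complex.conj_I, Complex.conj_ofReal]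
    push_cast; ring
  · have h1 := intervalIntegral.integral_comp_add_left (a := 0) (b := π - lam0)
      (fun l : ℝ => Complex.exp (Complex.I * (h : ℂ) * (l : ℂ)) * ((f l : ℝ) : ℂ)) lam0
    rw [add_zero, add_sub_cancel] at h1
    rw [← h1, ← intervalIntegral.integral_const_mul]
    refine intervalIntegral.integral_congr_ae ?_
    filter_upwards [Measure.ae_ne volume (π - lam0)] with x hx hmem
    rw [uIoc_of_le hsub.le] at hmem
    rw [hp x hmem.1 (lt_of_le_of_ne hmem.2 hx), ← mul_assoc, ← Complex.exp_add]
    congr 2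
    push_cast; ring

theorem propositionB1 {Ω : Type*} [MeasurableSpace Ω] (P : Measure Ω) [IsProbabilityMeasure P]
    (X : ℤ → Ω → ℝ) (lam0 d cm cp : ℝ) (Rm Rp Lm Lp : ℝ → ℝ)
    (hcm : 0 < cm) (hcp : 0 < cp)
    (hLm : IsQuasiMonotone (1 / lam0) Lm) (hLp : IsQuasiMonotone (1 / (π - lam0)) Lp)
    (hLm_lim : Tendsto Lm atTop (𝓝 cm)) (hLp_lim : Tendsto Lp atTop (𝓝 cp))
    (hRm : ∀ x, 0 < x → x < lam0 → Rm x = Lm (1 / x) - cm)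
    (hRp : ∀ x, 0 < x → x < π - lam0 → Rp x = Lp (1 / x) - cp)
    (hX : IsCLMSpectral P X lam0 d cm cp Rm Rp) :
    IsCLMTime P X lam0 d (clmConst d cm cp) (clmPhase d cm cp) ∧
      clmPhase d cm cp ∈ Ioo (-((1 / 2 - d) * π)) ((1 / 2 - d) * π) := by
  have hd := hX.d_mem
  have hl := hX.lam0_mem
  have hphase := clmPhase_mem hd hcm hcp
  have hd0 : 0 < 2 * d := by linarith [hd.1]
  have hd1 : 2 * d < 1 := by linarith [hd.2]
  refine ⟨⟨hX.stationary, hl, hd, ?_, Ioo_subset_Icc_self hphase, ?_⟩, hphase⟩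
  · exact mul_pos (mul_pos two_pos (Gamma_pos_of_pos (by linarith))) (clmModulus_pos hd hcm hcp)
  obtain ⟨f, hf, hfm, hfp⟩ := hX.density
  have hsub : 0 < π - lam0 := sub_pos.2 hl.2
  have hm : ∀ x, 0 < x → x < lam0 → f (lam0 - x) = Lm (1 / x) * x ^ (-(2 * d)) := by
    intro x hx hxl
    rw [hfm _ (by linarith) (by linarith), sub_sub_cancel, hRm x hx hxl, add_sub_cancel, neg_mul]
  have hp : ∀ x, 0 < x → x < π - lam0 → f (lam0 + x) = Lp (1 / x) * x ^ (-(2 * d)) := by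
    intro x hx hxl
    rw [hfp _ (by linarith) (by linarith), add_sub_cancel_left, hRp x hx hxl, add_sub_cancel,
      neg_mul]
  have hfi : IntervalIntegrable f volume 0 π :=
    hf.intervalIntegrable (by linarith [pi_pos]) pi_pos.le le_rfl
  have him : IntegrableOn (fun x => Lm (1 / x) * x ^ (-(2 * d))) (Ioo 0 lam0) := by
    have h1 := (hf.intervalIntegrable (p := 0) (q := lam0) (by linarith [pi_pos]) hl.1.le
      hl.2.le).comp_sub_left lam0
    rw [sub_zero, sub_self] at h1
    have h2 := (intervalIntegrable_iff_integrableOn_Ioo_of_le hl.1.le).1 h1.symm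
    exact h2.congr_fun (fun x hx => hm x hx.1 hx.2) measurableSet_Ioo
  have hip : IntegrableOn (fun x => Lp (1 / x) * x ^ (-(2 * d))) (Ioo 0 (π - lam0)) := by
    have h1 := (hf.intervalIntegrable (p := lam0) (q := π) (by linarith [pi_pos, hl.1]) hl.2.le
      le_rfl).comp_add_left lam0
    rw [sub_self] at h1
    have h2 := (intervalIntegrable_iff_integrableOn_Ioo_of_le hsub.le).1 h1
    exact h2.congr_fun (fun x hx => hp x hx.1 hx.2) measurableSet_Ioo
  have limm := hLm.tendsto_rpow_mul_integral hl.1 hd0 hd1 hLm_lim him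
  have limp := hLp.tendsto_rpow_mul_integral hsub hd0 hd1 hLp_lim hip
  have limS := (((Complex.continuous_conj.tendsto _).comp limm).add limp).comp
    (tendsto_natCast_atTop_atTop (R := ℝ))
  set S : ℂ := (starRingEnd ℂ) (cm * (Gamma (1 - 2 * d) *
      Complex.exp (Complex.I * (π * (1 - 2 * d) / 2 : ℝ))))
    + cp * (Gamma (1 - 2 * d) * Complex.exp (Complex.I * (π * (1 - 2 * d) / 2 : ℝ))) with hS
  set r : ℕ → ℝ := fun n => acvf P X n * (n : ℝ) ^ (1 - 2 * d)
    - clmConst d cm cp * cos (lam0 * n + clmPhase d cm cp) with hr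
  have hr0 : Tendsto r atTop (𝓝 0) := by
    have h0 := (tendsto_iff_norm_sub_tendsto_zero.1 limS).const_mul 2
    rw [mul_zero] at h0
    refine squeeze_zero_norm (fun n => ?_) h0
    simp only [Function.comp_apply]
    set Y : ℂ := (starRingEnd ℂ) (((((n : ℝ)) ^ (1 - 2 * d) : ℝ) : ℂ) * ∫ x in (0 : ℝ)..lam0,
        Complex.exp (Complex.I * ((n : ℝ) * x : ℝ)) * ((Lm (1 / x) * x ^ (-(2 * d)) : ℝ) : ℂ))
      + ((((n : ℝ)) ^ (1 - 2 * d) : ℝ) : ℂ) * ∫ x in (0 : ℝ)..π - lam0,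
        Complex.exp (Complex.I * ((n : ℝ) * x : ℝ)) * ((Lp (1 / x) * x ^ (-(2 * d)) : ℝ) : ℂ)
      with hY
    have e1 : r n = 2 * (Complex.exp (Complex.I * (lam0 * n : ℝ)) * (Y - S)).re := by
      have e2 := hf.eq_two_mul_re (acvf_neg hX.stationary) n
      have e3 := integral_cexp_mul_eq_recentred hl hfi hm hp n
      rw [Complex.ofReal_natCast] at e3
      rw [Int.cast_natCast, e3] at e2
      rw [hr]
      beta_reduce
      rw [e2, ← two_mul_re_cexp_mul_eq hd hcm hcp, ← hS, mul_sub, Complex.sub_re, mul_sub,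
        mul_assoc, mul_comm (Complex.re _), ← Complex.re_ofReal_mul]
      congr 3
      rw [hY, map_mul, Complex.conj_ofReal]
      ring
    rw [e1, norm_mul, norm_two]
    refine mul_le_mul_of_nonneg_left ?_ two_pos.le
    refine (Complex.abs_re_le_norm _).trans ?_
    rw [norm_mul, norm_cexp_I_mul_ofReal, one_mul]
  -- The remainder is given at integers only, and is extended to the reals as a step function.
  refine ⟨fun x => r ⌊x⌋₊, hr0.comp tendsto_nat_floor_atTop, fun h hh => ?_⟩
  have hh0 : (0 : ℝ) < h := by exact_mod_cast hh
  simp only [Nat.floor_natCast, hr]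
  rw [add_sub_cancel, mul_assoc, ← rpow_add hh0]
  simp
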